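/- Let $N\ge 1$, let $\alpha_1,\dots,\alpha_N$ be real numbers that are linearly independent over $\mathbb Q$, and let $p_0>0$ and $p_1,\dots,p_N\in(0,1)$ satisfy $\sum_{i=0}^N p_i=1$. Let $(u_j)_{j\ge 1}$ be independent real random variables on a probability space $(\Omega,\mathcal A,\mathbb P)$, each with law $$p_0\,\delta_0+\frac12\sum_{i=1}^N p_i\left(\delta_{\alpha_i}+\delta_{-\alpha_i}\right)$$ (where $\delta_x$ denotes the Dirac mass at $x$), and let $x_0=0$, $x_n=\sum_{j=1}^n u_j$. Put $\sigma=\left(\sum_{i=1}^N p_i\alpha_i^2\right)^{1/2}$. Let $\gamma\in(0,\tfrac12)$ and let $(\delta_n)_{n\ge1}$ be a sequence of positive real numbers with $\delta_n\to0$ and $\delta_n\ge n^{-(1/2-\gamma)}$ for all $n\ge1$. Then, as $n\to\infty$, $$\mathbb P\left[x_{2n}\in(-\delta_n^{-1},\delta_n^{-1})\right]\ \sim\ 2\,\delta_n^{-1}\,\frac{1}{\sqrt{2\pi(2n)}\,\sigma},$$ that is, the ratio of the two sides tends to $1$. -/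

import Mathlib

open MeasureTheory ProbabilityTheory

/-- The step law `p₀ δ_0 + (1/2) ∑ᵢ pᵢ (δ_{αᵢ} + δ_{-αᵢ})` on the real line. -/
noncomputable def stepLaw {N : ℕ} (α : Fin N → ℝ) (p₀ : ℝ) (p : Fin N → ℝ) : Measure ℝ :=
  ENNReal.ofReal p₀ • Measure.dirac 0 +
    ∑ i, ENNReal.ofReal (p i / 2) • (Measure.dirac (α i) + Measure.dirac (-α i))

/-- The position at time `n` of the walk started at `0` with increments `u 0, u 1, …`
(the increment at time `j + 1` is `u j`). -/
def walk {Ω : Type*} (u : ℕ → Ω → ℝ) (n : ℕ) (ω : Ω) : ℝ :=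
  ∑ j ∈ Finset.range n, u j ω

/-- The standard deviation `σ = (∑ᵢ pᵢ αᵢ²)^{1/2}` of one step. -/
noncomputable def stepSigma {N : ℕ} (α : Fin N → ℝ) (p : Fin N → ℝ) : ℝ :=
  Real.sqrt (∑ i, p i * α i ^ 2)

/-! Put R = 1/δ_n and m = 2n, and let μ_n be the law of x_m / R, so the event becomes (-1, 1) and
μ_n has characteristic function φ(w / R)^m, with φ that of one step. Test μ_n against the Fejér
kernel K times e^{isx}. Since K is the Fourier transform of the compactly supported tent function,
only bounded w contribute, and then w / R → 0: only φ(t) = 1 - t² q(t) / 2 near t = 0 matters, with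
q(0) = σ². No control of φ away from 0 is needed.

The substitution w = R x / √m and dominated convergence give (√m / R) ∫ K(x) e^{isx} dμ_n → tent(s)
√(2π) / σ (`tendsto_integral_tent_mul_pow`). The hypothesis on δ_n enters as R / √m → 0, which
freezes the tent at s. By Lévy's continuity theorem the rescaled measures K μ_n converge weakly to K
dx / 2π (`tendsto_integral_mul_fejerKernel`). As K is bounded below on [-2, 2], it can be divided
out, and sandwiching the indicator of (-1, 1) between trapezoids (`tendsto_measureReal_Ioo`) gives
the limit 2 / 2π = 1 / π. -/

/-! ### The tent function and the Fejér kernel as a Fourier pair. -/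

/-- The tent function `t ↦ (1 - |t|)₊`. -/
noncomputable def tent (t : ℝ) : ℝ := max 0 (1 - |t|)

/-- The Fejér kernel `x ↦ sinc (x / 2) ^ 2`, the Fourier transform of the tent function. -/
noncomputable def fejerKernel (x : ℝ) : ℝ := Real.sinc (x / 2) ^ 2

lemma continuous_tent : Continuous tent := by unfold tent; fun_prop

lemma tent_nonneg (t : ℝ) : 0 ≤ tent t := le_max_left _ _

lemma tent_le_one (t : ℝ) : tent t ≤ 1 :=
  max_le zero_le_one (by linarith [abs_nonneg t])

lemma tent_eq_zero {t : ℝ} (ht : 1 ≤ |t|) : tent t = 0 := max_eq_left (by linarith)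

lemma tent_zero : tent 0 = 1 := by simp [tent]

lemma tent_neg (t : ℝ) : tent (-t) = tent t := by simp [tent]

lemma hasCompactSupport_tent : HasCompactSupport tent :=
  HasCompactSupport.intro (isCompact_Icc (a := (-1 : ℝ)) (b := 1)) fun t ht =>
    tent_eq_zero (by
      by_contra! h
      exact ht ⟨(abs_lt.1 h).1.le, (abs_lt.1 h).2.le⟩)

lemma integrable_tent : Integrable tent :=
  continuous_tent.integrable_of_hasCompactSupport hasCompactSupport_tent

lemma continuous_fejerKernel : Continuous fejerKernel := by
  unfold fejerKernel
  exact (Real.continuous_sinc.comp (continuous_id.div_const 2)).pow 2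

lemma fejerKernel_nonneg (x : ℝ) : 0 ≤ fejerKernel x := sq_nonneg _

lemma fejerKernel_le_one (x : ℝ) : fejerKernel x ≤ 1 :=
  (sq_le_one_iff_abs_le_one _).2 (Real.abs_sinc_le_one _)

lemma fejerKernel_zero : fejerKernel 0 = 1 := by simp [fejerKernel]

/-- Half-angle formula in a division-free form, valid at 0. It yields the decay of the kernel, its
lower bound near 0, and the expansion of the step's characteristic function. -/
lemma fejerKernel_mul_sq (x : ℝ) : fejerKernel x * x ^ 2 = 2 * (1 - Real.cos x) := by
  rcases eq_or_ne x 0 with rfl | hx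
  · simp
  · have h : Real.cos x = 1 - 2 * Real.sin (x / 2) ^ 2 := by
      have h1 := Real.cos_sq' (x / 2)
      have h2 := Real.cos_two_mul (x / 2)
      rw [mul_div_cancel₀ x two_ne_zero] at h2
      linarith
    rw [fejerKernel, Real.sinc_of_ne_zero (by positivity), h]
    field_simp
    ring

lemma integrable_fejerKernel : Integrable fejerKernel := by
  -- 5 = 1 + 4: the kernel is at most 1, and the kernel times x² is at most 4.
  refine (integrable_inv_one_add_sq.const_mul 5).mono'
    continuous_fejerKernel.aestronglyMeasurable (ae_of_all _ fun x => ?_)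
  rw [Real.norm_of_nonneg (fejerKernel_nonneg x), ← div_eq_mul_inv, le_div_iff₀ (by positivity)]
  linarith [fejerKernel_mul_sq x, fejerKernel_le_one x, Real.neg_one_le_cos x]

/-- Follows from cos x ≤ 1 - (2 / π²) x² and π ≤ 4. The radius 2 leaves room around [-1, 1] for the
trapezoids. -/
lemma quarter_le_fejerKernel {x : ℝ} (hx : |x| ≤ 2) : 1 / 4 ≤ fejerKernel x := by
  rcases eq_or_ne x 0 with rfl | h0
  · rw [fejerKernel_zero]; norm_num
  have h1 := Real.cos_le_one_sub_mul_cos_sq (x := x) (by linarith [Real.pi_gt_three])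
  have h2 := fejerKernel_mul_sq x
  have hx2 : 0 < x ^ 2 := by positivity
  have h3 : 1 / 4 ≤ 2 * (2 / Real.pi ^ 2) := by
    have := Real.pi_le_four
    rw [← mul_div_assoc, div_le_div_iff₀ (by norm_num) (by positivity)]
    nlinarith [Real.pi_pos]
  have : 1 / 4 * x ^ 2 ≤ fejerKernel x * x ^ 2 := by nlinarith
  exact le_of_mul_le_mul_right this hx2

lemma integral_tent_mul_exp (x : ℝ) :
    ∫ t : ℝ, (tent t : ℂ) * Complex.exp (t * x * Complex.I) = fejerKernel x := by
  have hsupp : Function.support (fun t : ℝ => (tent t : ℂ) * Complex.exp (t * x * Complex.I)) ⊆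
      Set.Ioc (-1) 1 := fun t ht => by
    by_contra h
    refine ht ?_
    have : tent t = 0 := tent_eq_zero (by
      by_contra! h'
      exact h ⟨(abs_lt.1 h').1, (abs_lt.1 h').2.le⟩)
    simp [this]
  have hint : ∀ a b : ℝ, IntervalIntegrable
      (fun t : ℝ => (tent t : ℂ) * Complex.exp (t * x * Complex.I)) volume a b := fun a b => by
    have := continuous_tent
    exact Continuous.intervalIntegrable (by fun_prop) _ _
  rw [← intervalIntegral.integral_eq_integral_of_support_subset hsupp,
    ← intervalIntegral.integral_add_adjacent_intervals (hint (-1) 0) (hint 0 1)]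
  have e1 : ∫ t in (-1 : ℝ)..0, (tent t : ℂ) * Complex.exp (t * x * Complex.I) =
      ∫ t in (-1 : ℝ)..0, (1 + t : ℂ) * Complex.exp (t * x * Complex.I) := by
    refine intervalIntegral.integral_congr fun t ht => ?_
    rw [Set.uIcc_of_le (by norm_num)] at ht
    have : tent t = 1 + t := by
      rw [tent, abs_of_nonpos ht.2, max_eq_right (by linarith [ht.1])]; ring
    simp [this]
  have e2 : ∫ t in (0 : ℝ)..1, (tent t : ℂ) * Complex.exp (t * x * Complex.I) =
      ∫ t in (0 : ℝ)..1, (1 - t : ℂ) * Complex.exp (t * x * Complex.I) := by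
    refine intervalIntegral.integral_congr fun t ht => ?_
    rw [Set.uIcc_of_le (by norm_num)] at ht
    have : tent t = 1 - t := by
      rw [tent, abs_of_nonneg ht.1, max_eq_right (by linarith [ht.2])]
    simp [this]
  rw [e1, e2]
  have hE : ∀ t : ℝ, HasDerivAt (fun t : ℝ => Complex.exp (t * x * Complex.I))
      (Complex.exp (t * x * Complex.I) * (x * Complex.I)) t := fun t => by
    have h := (((hasDerivAt_id (t : ℂ)).mul_const (x : ℂ)).mul_const Complex.I).cexp.comp_ofReal
    simpa using h
  have hid : ∀ t : ℝ, HasDerivAt (fun t : ℝ => (t : ℂ)) 1 t := fun t => by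
    simpa using (hasDerivAt_id (t : ℂ)).comp_ofReal
  -- The antiderivatives used for x ≠ 0 divide by x.
  rcases eq_or_ne x 0 with rfl | hx
  · have f1 : ∫ t in (-1 : ℝ)..0, (1 + t : ℂ) = 0 - (-1 + (-1) ^ 2 / 2) := by
      have := intervalIntegral.integral_eq_sub_of_hasDerivAt (a := (-1 : ℝ)) (b := 0)
        (f := fun t : ℝ => (t : ℂ) + (t : ℂ) ^ 2 / 2) (f' := fun t : ℝ => (1 + t : ℂ))
        (fun t _ => by
          convert! (hid t).add (((hid t).pow 2).div_const 2) using 1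
          simp)
        (Continuous.intervalIntegrable (by fun_prop) _ _)
      simpa using this
    have f2 : ∫ t in (0 : ℝ)..1, (1 - t : ℂ) = 1 - 1 / 2 := by
      have := intervalIntegral.integral_eq_sub_of_hasDerivAt (a := (0 : ℝ)) (b := 1)
        (f := fun t : ℝ => (t : ℂ) - (t : ℂ) ^ 2 / 2) (f' := fun t : ℝ => (1 - t : ℂ))
        (fun t _ => by
          convert! (hid t).sub (((hid t).pow 2).div_const 2) using 1
          simp)
        (Continuous.intervalIntegrable (by fun_prop) _ _)
      simpa using this
    simp only [Complex.ofReal_zero, mul_zero, zero_mul, Complex.exp_zero, mul_one, f1, f2,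
      fejerKernel_zero]
    norm_num
  · have hx' : (x : ℂ) ≠ 0 := by exact_mod_cast hx
    have f1 := intervalIntegral.integral_eq_sub_of_hasDerivAt (a := (-1 : ℝ)) (b := 0)
        (f := fun t : ℝ => (1 + (t : ℂ)) * Complex.exp (t * x * Complex.I) / (x * Complex.I) +
          Complex.exp (t * x * Complex.I) / x ^ 2)
        (f' := fun t : ℝ => (1 + t : ℂ) * Complex.exp (t * x * Complex.I))
        (fun t _ => by
          convert! ((((hid t).const_add 1).mul (hE t)).div_const (x * Complex.I)).add
            ((hE t).div_const ((x : ℂ) ^ 2)) using 1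
          field_simp
          linear_combination -Complex.I_sq)
        (Continuous.intervalIntegrable (by fun_prop) _ _)
    have f2 := intervalIntegral.integral_eq_sub_of_hasDerivAt (a := (0 : ℝ)) (b := 1)
        (f := fun t : ℝ => (1 - (t : ℂ)) * Complex.exp (t * x * Complex.I) / (x * Complex.I) -
          Complex.exp (t * x * Complex.I) / x ^ 2)
        (f' := fun t : ℝ => (1 - t : ℂ) * Complex.exp (t * x * Complex.I))
        (fun t _ => by
          convert! ((((hid t).const_sub 1).mul (hE t)).div_const (x * Complex.I)).sub
            ((hE t).div_const ((x : ℂ) ^ 2)) using 1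
          field_simp
          linear_combination Complex.I_sq)
        (Continuous.intervalIntegrable (by fun_prop) _ _)
    rw [f1, f2]
    have h := fejerKernel_mul_sq x
    have hH : (fejerKernel x : ℂ) = 2 * (1 - Complex.cos x) / x ^ 2 := by
      rw [eq_div_iff (by simpa using hx)]
      exact_mod_cast h
    rw [hH, Complex.cos]
    simp
    field_simp
    ring

lemma fourier_tent (w : ℝ) :
    FourierTransform.fourier (fun t => (tent t : ℂ)) w = fejerKernel (2 * Real.pi * w) := by
  rw [Real.fourier_real_eq_integral_exp_smul]
  have : fejerKernel (2 * Real.pi * w) = fejerKernel (-2 * Real.pi * w) := by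
    rw [fejerKernel, fejerKernel, ← Real.sinc_neg]; ring_nf
  rw [this, ← integral_tent_mul_exp]
  refine integral_congr_ae (ae_of_all _ fun t => ?_)
  simp only [smul_eq_mul]
  rw [mul_comm]
  push_cast
  ring_nf

/-- Fourier inversion for the tent, rescaled by 2π to match the convention of `charFun`. -/
lemma integral_fejerKernel_mul_exp (s : ℝ) :
    ∫ x : ℝ, (fejerKernel x : ℂ) * Complex.exp (s * x * Complex.I) =
      (2 * Real.pi * tent s : ℝ) := by
  have hcont : Continuous fun t => (tent t : ℂ) := Complex.continuous_ofReal.comp continuous_tent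
  have hF : FourierTransform.fourier (fun t => (tent t : ℂ)) =
      fun w => ((fejerKernel (2 * Real.pi * w) : ℝ) : ℂ) := funext fourier_tent
  have hpi : (2 * Real.pi) ≠ 0 := by positivity
  have hint : Integrable (FourierTransform.fourier fun t => (tent t : ℂ)) := by
    rw [hF]
    exact (integrable_fejerKernel.comp_mul_left' hpi).ofReal
  have h := congrFun (hcont.fourierInv_fourier_eq integrable_tent.ofReal hint) s
  rw [hF, Real.fourierInv_eq'] at h
  have h2 := Measure.integral_comp_mul_left
    (fun x : ℝ => (fejerKernel x : ℂ) * Complex.exp (s * x * Complex.I)) (2 * Real.pi)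
  have h3 : ∫ x : ℝ, (fejerKernel (2 * Real.pi * x) : ℂ) *
      Complex.exp (s * (2 * Real.pi * x : ℝ) * Complex.I) = tent s := by
    rw [← h]
    refine integral_congr_ae (ae_of_all _ fun t => ?_)
    simp only [smul_eq_mul]
    rw [mul_comm]
    congr 3
    simp
    ring
  rw [h3, abs_of_pos (by positivity), eq_inv_smul_iff₀ hpi] at h2
  rw [← h2]
  simp

lemma integral_fejerKernel : ∫ x, fejerKernel x = 2 * Real.pi := by
  have h := integral_fejerKernel_mul_exp 0
  simp only [Complex.ofReal_zero, zero_mul, Complex.exp_zero, mul_one, tent_zero] at h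
  rw [integral_complex_ofReal] at h
  exact_mod_cast h

/-! ### Weak convergence of Fejér-weighted measures. -/

open Filter Topology BoundedContinuousFunction

/-- The finite measure with density the Fejér kernel with respect to `μ`. -/
noncomputable def fejerMeasure (μ : Measure ℝ) (hμ : Integrable fejerKernel μ) :
    FiniteMeasure ℝ :=
  ⟨μ.withDensity fun x => ENNReal.ofReal (fejerKernel x),
    isFiniteMeasure_withDensity_ofReal hμ.2⟩

lemma integral_fejerMeasure {E : Type*} [NormedAddCommGroup E] [NormedSpace ℝ E]
    {μ : Measure ℝ} (hμ : Integrable fejerKernel μ) (g : ℝ → E) :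
    ∫ x, g x ∂(fejerMeasure μ hμ : Measure ℝ) = ∫ x, fejerKernel x • g x ∂μ := by
  change ∫ x, g x ∂(μ.withDensity fun x => ENNReal.ofReal (fejerKernel x)) = _
  rw [integral_withDensity_eq_integral_toReal_smul
    continuous_fejerKernel.measurable.ennreal_ofReal (ae_of_all _ fun _ => ENNReal.ofReal_lt_top)]
  simp_rw [ENNReal.toReal_ofReal (fejerKernel_nonneg _)]

lemma integral_normalize_fejerMeasure {E : Type*} [NormedAddCommGroup E] [NormedSpace ℝ E]
    {μ : Measure ℝ} (hμ : Integrable fejerKernel μ) (h0 : ∫ x, fejerKernel x ∂μ ≠ 0)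
    (g : ℝ → E) :
    ∫ x, g x ∂((fejerMeasure μ hμ).normalize : Measure ℝ) =
      (∫ x, fejerKernel x ∂μ)⁻¹ • ∫ x, fejerKernel x • g x ∂μ := by
  have hmass : (fejerMeasure μ hμ : Measure ℝ).real Set.univ = ∫ x, fejerKernel x ∂μ := by
    have := integral_fejerMeasure hμ (fun _ => (1 : ℝ))
    simpa using this
  have hne : fejerMeasure μ hμ ≠ 0 := fun h => h0 (by rw [← hmass, h]; simp)
  rw [← (fejerMeasure μ hμ).average_eq_integral_normalize hne, average_eq, hmass,
    integral_fejerMeasure]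

lemma charFun_normalize_fejerMeasure {μ : Measure ℝ} (hμ : Integrable fejerKernel μ)
    (h0 : ∫ x, fejerKernel x ∂μ ≠ 0) (s : ℝ) :
    charFun ((fejerMeasure μ hμ).normalize : Measure ℝ) s =
      ((∫ x, fejerKernel x ∂μ : ℝ) : ℂ)⁻¹ *
        ∫ x, (fejerKernel x : ℂ) * Complex.exp (s * x * Complex.I) ∂μ := by
  rw [charFun_apply_real, integral_normalize_fejerMeasure hμ h0]
  simp [Complex.real_smul]

/-- If the Fourier transforms of the measures `a n • fejerKernel • μ n` converge pointwise to the
tent function, then these measures converge weakly to `(2π)⁻¹ • fejerKernel • volume`. -/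
lemma tendsto_integral_mul_fejerKernel {μ : ℕ → Measure ℝ} [∀ n, IsProbabilityMeasure (μ n)]
    {a : ℕ → ℝ}
    (h : ∀ s : ℝ, Tendsto (fun n => (a n : ℂ) *
      ∫ x, (fejerKernel x : ℂ) * Complex.exp (s * x * Complex.I) ∂μ n) atTop (𝓝 (tent s)))
    (f : ℝ →ᵇ ℝ) :
    Tendsto (fun n => a n * ∫ x, fejerKernel x * f x ∂μ n) atTop
      (𝓝 ((2 * Real.pi)⁻¹ * ∫ x, fejerKernel x * f x)) := by
  have hint : ∀ n, Integrable fejerKernel (μ n) := fun n =>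
    (integrable_const (1 : ℝ)).mono' continuous_fejerKernel.aestronglyMeasurable
      (ae_of_all _ fun x => by
        rw [Real.norm_of_nonneg (fejerKernel_nonneg x)]; exact fejerKernel_le_one x)
  have hmass : Tendsto (fun n => a n * ∫ x, fejerKernel x ∂μ n) atTop (𝓝 1) := by
    have := (Complex.continuous_re.tendsto _).comp (h 0)
    simp only [Complex.ofReal_zero, zero_mul, Complex.exp_zero, mul_one, tent_zero] at this
    refine this.congr fun n => ?_
    simp only [Function.comp]
    rw [integral_complex_ofReal, ← Complex.ofReal_mul, Complex.ofReal_re]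
  have hne : ∀ᶠ n in atTop, a n * ∫ x, fejerKernel x ∂μ n ≠ 0 :=
    hmass.eventually_ne one_ne_zero
  have hvol : ∫ x, fejerKernel x ≠ 0 := by
    rw [integral_fejerKernel]; positivity
  -- Normalising gives probability measures, as Lévy's theorem requires. The factor `a n` cancels
  -- there and is restored by the total mass, which is the case s = 0 of `h`.
  have hconv : Tendsto (fun n => (fejerMeasure (μ n) (hint n)).normalize) atTop
      (𝓝 (fejerMeasure volume integrable_fejerKernel).normalize) := by
    refine ProbabilityMeasure.tendsto_of_tendsto_charFun fun s => ?_
    have hlim : charFun ((fejerMeasure volume integrable_fejerKernel).normalize : Measure ℝ) s =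
        (1 : ℂ)⁻¹ * tent s := by
      have hpi : (Real.pi : ℂ) ≠ 0 := by exact_mod_cast Real.pi_ne_zero
      rw [charFun_normalize_fejerMeasure _ hvol, integral_fejerKernel_mul_exp,
        integral_fejerKernel]
      push_cast
      field_simp
    rw [hlim]
    have hm : Tendsto (fun n => ((a n * ∫ x, fejerKernel x ∂μ n : ℝ) : ℂ)) atTop (𝓝 1) := by
      exact_mod_cast (Complex.continuous_ofReal.tendsto _).comp hmass
    refine ((hm.inv₀ one_ne_zero).mul (h s)).congr' ?_
    filter_upwards [hne] with n hn
    rw [charFun_normalize_fejerMeasure _ (right_ne_zero_of_mul hn)]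
    have h1 : (a n : ℂ) ≠ 0 := by exact_mod_cast left_ne_zero_of_mul hn
    push_cast
    rw [mul_inv, mul_mul_mul_comm, inv_mul_cancel₀ h1, one_mul]
  have h1 := (ProbabilityMeasure.tendsto_iff_forall_integral_tendsto.1 hconv) f
  rw [integral_normalize_fejerMeasure _ hvol, integral_fejerKernel] at h1
  have h2 := hmass.mul h1
  simp only [one_mul, smul_eq_mul] at h2
  refine h2.congr' ?_
  filter_upwards [hne] with n hn
  have h0 := right_ne_zero_of_mul hn
  rw [integral_normalize_fejerMeasure _ h0]
  simp only [smul_eq_mul]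
  rw [mul_assoc, mul_inv_cancel_left₀ h0]

/-- Apply the weak limit to ψ / K. The maximum with 1/4 keeps the quotient continuous and bounded at
the zeros of K, and changes nothing on [-2, 2], where ψ lives. -/
lemma tendsto_integral_of_support_subset {μ : ℕ → Measure ℝ} [∀ n, IsProbabilityMeasure (μ n)]
    {a : ℕ → ℝ}
    (h : ∀ s : ℝ, Tendsto (fun n => (a n : ℂ) *
      ∫ x, (fejerKernel x : ℂ) * Complex.exp (s * x * Complex.I) ∂μ n) atTop (𝓝 (tent s)))
    {ψ : ℝ → ℝ} (hψ : Continuous ψ) {C : ℝ} (hC : ∀ x, |ψ x| ≤ C)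
    (hsupp : ∀ x, 2 < |x| → ψ x = 0) :
    Tendsto (fun n => a n * ∫ x, ψ x ∂μ n) atTop (𝓝 ((2 * Real.pi)⁻¹ * ∫ x, ψ x)) := by
  have hpos : ∀ x, 0 < max (fejerKernel x) (1 / 4) := fun x => lt_max_of_lt_right (by norm_num)
  let f : ℝ →ᵇ ℝ := BoundedContinuousFunction.ofNormedAddCommGroup
    (fun x => ψ x / max (fejerKernel x) (1 / 4))
    (hψ.div (continuous_fejerKernel.max continuous_const) fun x => (hpos x).ne') (4 * C)
    (fun x => by
      rw [norm_div, Real.norm_eq_abs, Real.norm_of_nonneg (hpos x).le, div_le_iff₀ (hpos x)]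
      have := hC x
      have := abs_nonneg (ψ x)
      have := le_max_right (fejerKernel x) (1 / 4)
      nlinarith)
  have hf : ∀ x, fejerKernel x * f x = ψ x := fun x => by
    change fejerKernel x * (ψ x / max (fejerKernel x) (1 / 4)) = ψ x
    rcases lt_or_ge 2 |x| with hx | hx
    · simp [hsupp x hx]
    · have := quarter_le_fejerKernel hx
      rw [max_eq_left this, mul_div_cancel₀]
      linarith
  simpa only [hf] using tendsto_integral_mul_fejerKernel h f

/-! ### Sandwiching the indicator of an interval. -/

/-- The trapezoid function equal to `1` on `[-r, r]`, vanishing outside `(-(r + ε), r + ε)` and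
affine in between. -/
noncomputable def trapezoid (r ε x : ℝ) : ℝ := max 0 (min 1 ((r + ε - |x|) / ε))

lemma continuous_trapezoid (r ε : ℝ) : Continuous (trapezoid r ε) := by
  unfold trapezoid; fun_prop

lemma trapezoid_nonneg (r ε x : ℝ) : 0 ≤ trapezoid r ε x := le_max_left _ _

lemma trapezoid_le_one (r ε x : ℝ) : trapezoid r ε x ≤ 1 :=
  max_le zero_le_one (min_le_left _ _)

lemma trapezoid_eq_one {r ε x : ℝ} (hε : 0 < ε) (hx : |x| ≤ r) : trapezoid r ε x = 1 := by
  rw [trapezoid, min_eq_left ((one_le_div hε).2 (by linarith)), max_eq_right zero_le_one]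

lemma trapezoid_eq_zero {r ε x : ℝ} (hε : 0 < ε) (hx : r + ε ≤ |x|) : trapezoid r ε x = 0 :=
  max_eq_left ((min_le_right _ _).trans (div_nonpos_of_nonpos_of_nonneg (by linarith) hε.le))

lemma integrable_trapezoid {μ : Measure ℝ} [IsFiniteMeasureOnCompacts μ] (r : ℝ) {ε : ℝ}
    (hε : 0 < ε) : Integrable (trapezoid r ε) μ :=
  (continuous_trapezoid r ε).integrable_of_hasCompactSupport
    (HasCompactSupport.intro (isCompact_Icc (a := -(r + ε)) (b := r + ε)) fun x hx =>
      trapezoid_eq_zero hε (by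
        by_contra! h
        exact hx ⟨(abs_lt.1 h).1.le, (abs_lt.1 h).2.le⟩))

lemma integral_trapezoid_le {μ : Measure ℝ} [IsLocallyFiniteMeasure μ] (r : ℝ) {ε : ℝ}
    (hε : 0 < ε) : ∫ x, trapezoid r ε x ∂μ ≤ μ.real (Set.Ioo (-(r + ε)) (r + ε)) := by
  rw [← integral_indicator_one measurableSet_Ioo]
  refine integral_mono (integrable_trapezoid r hε)
    ((integrable_indicator_iff measurableSet_Ioo).2
      (integrableOn_const measure_Ioo_lt_top.ne)) fun x => ?_
  by_cases hx : x ∈ Set.Ioo (-(r + ε)) (r + ε)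
  · rw [Set.indicator_of_mem hx]
    exact trapezoid_le_one r ε x
  · rw [trapezoid_eq_zero hε (by
      by_contra! h
      exact hx (abs_lt.1 h)), Set.indicator_of_notMem hx]

lemma le_integral_trapezoid {μ : Measure ℝ} [IsLocallyFiniteMeasure μ] (r : ℝ) {ε : ℝ}
    (hε : 0 < ε) : μ.real (Set.Ioo (-r) r) ≤ ∫ x, trapezoid r ε x ∂μ := by
  rw [← integral_indicator_one measurableSet_Ioo]
  refine integral_mono ((integrable_indicator_iff measurableSet_Ioo).2
      (integrableOn_const measure_Ioo_lt_top.ne)) (integrable_trapezoid r hε) fun x => ?_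
  by_cases hx : x ∈ Set.Ioo (-r) r
  · rw [Set.indicator_of_mem hx, trapezoid_eq_one hε (abs_lt.2 hx).le, Pi.one_apply]
  · rw [Set.indicator_of_notMem hx]
    exact trapezoid_nonneg r ε x

lemma tendsto_measureReal_Ioo {μ : ℕ → Measure ℝ} [∀ n, IsProbabilityMeasure (μ n)]
    {a : ℕ → ℝ} (ha : ∀ᶠ n in atTop, 0 ≤ a n)
    (h : ∀ s : ℝ, Tendsto (fun n => (a n : ℂ) *
      ∫ x, (fejerKernel x : ℂ) * Complex.exp (s * x * Complex.I) ∂μ n) atTop (𝓝 (tent s))) :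
    Tendsto (fun n => a n * (μ n).real (Set.Ioo (-1) 1)) atTop (𝓝 Real.pi⁻¹) := by
  have hpi := Real.pi_pos
  have htr : ∀ r ε : ℝ, 0 < ε → r + ε ≤ 2 → Tendsto (fun n => a n * ∫ x, trapezoid r ε x ∂μ n)
      atTop (𝓝 ((2 * Real.pi)⁻¹ * ∫ x, trapezoid r ε x)) := fun r ε hε hr =>
    tendsto_integral_of_support_subset h (continuous_trapezoid r ε) (C := 1)
      (fun x => by rw [abs_of_nonneg (trapezoid_nonneg r ε x)]; exact trapezoid_le_one r ε x)
      (fun x hx => trapezoid_eq_zero hε (hr.trans hx.le))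
  have hIoo : ∀ r : ℝ, 0 ≤ r → volume.real (Set.Ioo (-r) r) = 2 * r := fun r hr => by
    rw [Real.volume_real_Ioo_of_le (by linarith)]; ring
  refine tendsto_order.2 ⟨fun b hb => ?_, fun b hb => ?_⟩
  · obtain ⟨ε, hε, hε1, hbε⟩ : ∃ ε : ℝ, 0 < ε ∧ ε < 1 ∧ b < Real.pi⁻¹ * (1 - ε) := by
      have : Tendsto (fun ε : ℝ => Real.pi⁻¹ * (1 - ε)) (𝓝[>] 0) (𝓝 (Real.pi⁻¹ * (1 - 0))) :=
        ((by fun_prop : Continuous fun ε : ℝ => Real.pi⁻¹ * (1 - ε)).tendsto 0).mono_left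
          nhdsWithin_le_nhds
      obtain ⟨ε, h1, h2, h3⟩ := ((this.eventually (lt_mem_nhds (by simpa using hb))).and
        (Ioo_mem_nhdsGT (zero_lt_one' ℝ))).exists
      exact ⟨ε, h2, h3, h1⟩
    have hlow := le_integral_trapezoid (μ := volume) (1 - ε) hε
    rw [hIoo _ (by linarith)] at hlow
    have : b < (2 * Real.pi)⁻¹ * ∫ x, trapezoid (1 - ε) ε x :=
      calc b < Real.pi⁻¹ * (1 - ε) := hbε
        _ = (2 * Real.pi)⁻¹ * (2 * (1 - ε)) := by field_simp
        _ ≤ _ := by gcongr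
    filter_upwards [(htr (1 - ε) ε hε (by linarith)).eventually (lt_mem_nhds this), ha] with n hn ha
    refine hn.trans_le (mul_le_mul_of_nonneg_left ?_ ha)
    simpa using integral_trapezoid_le (μ := μ n) (1 - ε) hε
  · obtain ⟨ε, hε, hε1, hbε⟩ : ∃ ε : ℝ, 0 < ε ∧ ε < 1 ∧ Real.pi⁻¹ * (1 + ε) < b := by
      have : Tendsto (fun ε : ℝ => Real.pi⁻¹ * (1 + ε)) (𝓝[>] 0) (𝓝 (Real.pi⁻¹ * (1 + 0))) :=
        ((by fun_prop : Continuous fun ε : ℝ => Real.pi⁻¹ * (1 + ε)).tendsto 0).mono_left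
          nhdsWithin_le_nhds
      obtain ⟨ε, h1, h2, h3⟩ := ((this.eventually (gt_mem_nhds (by simpa using hb))).and
        (Ioo_mem_nhdsGT (zero_lt_one' ℝ))).exists
      exact ⟨ε, h2, h3, h1⟩
    have hup := integral_trapezoid_le (μ := volume) 1 hε
    rw [hIoo _ (by linarith)] at hup
    have : (2 * Real.pi)⁻¹ * ∫ x, trapezoid 1 ε x < b :=
      calc _ ≤ (2 * Real.pi)⁻¹ * (2 * (1 + ε)) := by gcongr
        _ = Real.pi⁻¹ * (1 + ε) := by field_simp
        _ < b := hbε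
    filter_upwards [(htr 1 ε hε (by linarith)).eventually (gt_mem_nhds this), ha] with n hn ha
    exact (mul_le_mul_of_nonneg_left (le_integral_trapezoid (μ := μ n) 1 hε) ha).trans_lt hn

/-! ### From Fejér integrals to characteristic functions. -/

/-- Fubini: modulating the kernel by s shifts its transform, the tent, by s. -/
lemma integral_fejerKernel_mul_exp_eq_integral_charFun (μ : Measure ℝ) [IsFiniteMeasure μ]
    (s : ℝ) :
    ∫ x, (fejerKernel x : ℂ) * Complex.exp (s * x * Complex.I) ∂μ =
      ∫ w, (tent (w - s) : ℂ) * charFun μ w := by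
  have hcont := continuous_tent
  have h1 : ∀ x : ℝ, (fejerKernel x : ℂ) * Complex.exp (s * x * Complex.I) =
      ∫ w : ℝ, (tent (w - s) : ℂ) * Complex.exp (w * x * Complex.I) := fun x => by
    rw [← integral_tent_mul_exp, ← integral_mul_const,
      ← integral_sub_right_eq_self (fun t : ℝ => (tent t : ℂ) * Complex.exp (t * x * Complex.I) *
        Complex.exp (s * x * Complex.I)) s]
    refine integral_congr_ae (ae_of_all _ fun w => ?_)
    simp only
    rw [mul_assoc, ← Complex.exp_add]
    push_cast
    ring_nf
  simp_rw [h1, charFun_apply_real, ← integral_const_mul]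
  refine integral_integral_swap ?_
  have hdom : Integrable (fun z : ℝ × ℝ => tent (z.2 - s)) (μ.prod volume) :=
    (integrable_tent.comp_sub_right s).comp_snd μ
  refine hdom.mono' (Continuous.aestronglyMeasurable ?_) (ae_of_all _ fun z => ?_)
  · simp only [Function.uncurry_def]
    fun_prop
  · simp only [Function.uncurry_def]
    rw [norm_mul, ← Complex.ofReal_mul, Complex.norm_exp_ofReal_mul_I, mul_one, Complex.norm_real,
      Real.norm_of_nonneg (tent_nonneg _)]

/-! ### Gaussian asymptotics from the behaviour of φ at 0. -/

section LocalExpansion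

variable {φ q : ℝ → ℝ}

lemma tendsto_pow_of_local_expansion (hq : ContinuousAt q 0)
    (hφ : ∀ t, φ t = 1 - t ^ 2 / 2 * q t) (x : ℝ) :
    Tendsto (fun m : ℕ => φ (x / √m) ^ m) atTop (𝓝 (Real.exp (-(q 0 / 2) * x ^ 2))) := by
  have h0 : Tendsto (fun m : ℕ => x / √m) atTop (𝓝 0) :=
    (Real.tendsto_sqrt_atTop.comp tendsto_natCast_atTop_atTop).const_div_atTop x
  have hlim : Tendsto (fun m : ℕ => (m : ℝ) * (-((x / √m) ^ 2 / 2 * q (x / √m)))) atTop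
      (𝓝 (-(q 0 / 2) * x ^ 2)) := by
    have h1 := (hq.tendsto.comp h0).const_mul (-(x ^ 2 / 2))
    rw [show -(q 0 / 2) * x ^ 2 = -(x ^ 2 / 2) * q 0 by ring]
    refine h1.congr' ?_
    filter_upwards [eventually_gt_atTop 0] with m hm
    have hm' : (m : ℝ) ≠ 0 := by positivity
    rw [Function.comp, div_pow, Real.sq_sqrt m.cast_nonneg]
    field_simp
  refine (Real.tendsto_one_add_pow_exp_of_tendsto hlim).congr fun m => ?_
  rw [hφ, sub_eq_add_neg]

/-- Near 0 one has q > q(0) / 2 and φ > 0, so 1 - y ≤ e^{-y} applies. This supplies the Gaussian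
majorant for dominated convergence. -/
lemma exists_abs_le_exp_of_local_expansion (hq : ContinuousAt q 0) (hq0 : 0 < q 0)
    (hφ : ∀ t, φ t = 1 - t ^ 2 / 2 * q t) :
    ∃ η > 0, ∀ t, |t| < η → |φ t| ≤ Real.exp (-(q 0 / 4) * t ^ 2) := by
  have h1 : ∀ᶠ t in 𝓝 0, q 0 / 2 < q t := hq.eventually (lt_mem_nhds (by linarith))
  have h2 : ∀ᶠ t in 𝓝 0, t ^ 2 / 2 * q t < 1 := by
    have : ContinuousAt (fun t => t ^ 2 / 2 * q t) 0 := by fun_prop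
    exact this.eventually (gt_mem_nhds (by simp))
  obtain ⟨η, hη, h⟩ := Metric.eventually_nhds_iff.1 (h1.and h2)
  refine ⟨η, hη, fun t ht => ?_⟩
  obtain ⟨ha, hb⟩ := h (y := t) (by simpa [Real.dist_eq] using ht)
  rw [hφ, abs_of_nonneg (by linarith)]
  have h3 := Real.add_one_le_exp (-(q 0 / 4) * t ^ 2)
  nlinarith [sq_nonneg t]

lemma tendsto_integral_tent_mul_pow (hφc : Continuous φ) (hq : ContinuousAt q 0) (hq0 : 0 < q 0)
    (hφ : ∀ t, φ t = 1 - t ^ 2 / 2 * q t) {R : ℕ → ℝ} (hR : Tendsto R atTop atTop)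
    {m : ℕ → ℕ} (hm : Tendsto m atTop atTop)
    (hRm : Tendsto (fun n => R n / √(m n)) atTop (𝓝 0)) (s : ℝ) :
    Tendsto (fun n => √(m n) / R n * ∫ w, tent (w - s) * φ (w / R n) ^ m n) atTop
      (𝓝 (tent s * √(2 * Real.pi / q 0))) := by
  obtain ⟨η, hη, hbound⟩ := exists_abs_le_exp_of_local_expansion hq hq0 hφ
  have hcont := continuous_tent
  have hpos : ∀ᶠ n in atTop, 0 < R n ∧ 0 < m n :=
    (hR.eventually_gt_atTop 0).and (hm.eventually_gt_atTop 0)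
  have key : Tendsto (fun n => ∫ x, tent (R n / √(m n) * x - s) * φ (x / √(m n)) ^ m n) atTop
      (𝓝 (∫ x, tent s * Real.exp (-(q 0 / 2) * x ^ 2))) := by
    refine tendsto_integral_filter_of_dominated_convergence
      (fun x => Real.exp (-(q 0 / 4) * x ^ 2)) ?_ ?_
      (integrable_exp_neg_mul_sq (by positivity)) ?_
    · exact Eventually.of_forall fun n =>
        Continuous.aestronglyMeasurable (by fun_prop)
    -- Where the tent is nonzero, the argument of φ is below (1 + |s|) / R in absolute value; this
    -- threshold on R puts it inside the η-neighbourhood.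
    · filter_upwards [hpos, hR.eventually_gt_atTop ((1 + |s|) / η)] with n ⟨hRn, hmn⟩ hRη
      refine ae_of_all _ fun x => ?_
      have hsq : 0 < √(m n : ℝ) := Real.sqrt_pos.2 (by exact_mod_cast hmn)
      rcases le_or_gt 1 |R n / √(m n) * x - s| with hx | hx
      · rw [tent_eq_zero hx, zero_mul, norm_zero]
        positivity
      · have hxη : |x / √(m n)| < η := by
          have h1 : R n * |x / √(m n)| < 1 + |s| := by
            have : R n * |x / √(m n)| = |(R n / √(m n) * x - s) + s| := by
              rw [← abs_of_pos hRn, ← abs_mul, abs_of_pos hRn]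
              ring_nf
            rw [this]
            exact (abs_add_le _ _).trans_lt (by linarith)
          rw [div_lt_iff₀ hη] at hRη
          exact lt_of_mul_lt_mul_left (h1.trans hRη) hRn.le
        rw [norm_mul, norm_pow, Real.norm_of_nonneg (tent_nonneg _), Real.norm_eq_abs]
        calc tent (R n / √(m n) * x - s) * |φ (x / √(m n))| ^ m n
            ≤ 1 * Real.exp (-(q 0 / 4) * (x / √(m n)) ^ 2) ^ m n := by
              gcongr
              · exact tent_le_one _
              · exact hbound _ hxη
          _ = Real.exp (-(q 0 / 4) * x ^ 2) := by
              rw [one_mul, ← Real.exp_nat_mul, div_pow, Real.sq_sqrt (Nat.cast_nonneg _)]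
              have : (m n : ℝ) ≠ 0 := by positivity
              congr 1
              field_simp
    · refine ae_of_all _ fun x => ?_
      have h1 : Tendsto (fun n => tent (R n / √(m n) * x - s)) atTop (𝓝 (tent s)) := by
        rw [← tent_neg s]
        have := (hcont.tendsto (0 * x - s)).comp ((hRm.mul_const x).sub_const s)
        rwa [zero_mul, zero_sub] at this
      exact h1.mul ((tendsto_pow_of_local_expansion hq hφ x).comp hm)
  rw [integral_const_mul, integral_gaussian] at key
  rw [show Real.pi / (q 0 / 2) = 2 * Real.pi / q 0 by field_simp] at key
  refine key.congr' ?_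
  filter_upwards [hpos] with n ⟨hRn, hmn⟩
  have hsq : 0 < √(m n : ℝ) := Real.sqrt_pos.2 (by exact_mod_cast hmn)
  have h := Measure.integral_comp_mul_left
    (fun w => tent (w - s) * φ (w / R n) ^ m n) (R n / √(m n))
  rw [inv_div, abs_of_pos (by positivity), smul_eq_mul] at h
  rw [← h]
  refine integral_congr_ae (ae_of_all _ fun x => ?_)
  simp only
  congr 3
  field_simp

end LocalExpansion

lemma integral_tent_mul_charFun_eq_ofReal {μ : Measure ℝ} {g : ℝ → ℝ}
    (hg : ∀ w, charFun μ w = g w) (s : ℝ) :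
    ∫ w, (tent (w - s) : ℂ) * charFun μ w = (∫ w, tent (w - s) * g w : ℝ) := by
  rw [← integral_complex_ofReal]
  simp [hg]

/-- A local limit theorem at intermediate scales: if `μ n` has characteristic function
`w ↦ φ (w / R n) ^ m n`, where `φ t = 1 - t² q t / 2` and `1 ≪ R n ≪ √(m n)`, then
`μ n (-1, 1)` is equivalent to `2 R n / √(2π q(0) (m n))`. -/
lemma tendsto_measureReal_Ioo_of_charFun_eq_pow {φ q : ℝ → ℝ} (hφc : Continuous φ)
    (hq : ContinuousAt q 0) (hq0 : 0 < q 0) (hφ : ∀ t, φ t = 1 - t ^ 2 / 2 * q t)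
    {R : ℕ → ℝ} (hR : Tendsto R atTop atTop) {m : ℕ → ℕ} (hm : Tendsto m atTop atTop)
    (hRm : Tendsto (fun n => R n / √(m n)) atTop (𝓝 0))
    {μ : ℕ → Measure ℝ} [∀ n, IsProbabilityMeasure (μ n)]
    (hμ : ∀ n w, charFun (μ n) w = (φ (w / R n) ^ m n : ℝ)) :
    Tendsto (fun n => √(m n) / R n * (√(2 * Real.pi / q 0))⁻¹ * (μ n).real (Set.Ioo (-1) 1))
      atTop (𝓝 Real.pi⁻¹) := by
  have hK : √(2 * Real.pi / q 0) ≠ 0 := by positivity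
  refine tendsto_measureReal_Ioo ?_ fun s => ?_
  · filter_upwards [hR.eventually_gt_atTop 0] with n hn
    positivity
  · have h := (tendsto_integral_tent_mul_pow hφc hq hq0 hφ hR hm hRm s).mul_const
      (√(2 * Real.pi / q 0))⁻¹
    rw [mul_assoc, mul_inv_cancel₀ hK, mul_one] at h
    refine ((Complex.continuous_ofReal.tendsto _).comp h).congr fun n => ?_
    rw [integral_fejerKernel_mul_exp_eq_integral_charFun,
      integral_tent_mul_charFun_eq_ofReal (hμ n), Function.comp, ← Complex.ofReal_mul,
      mul_right_comm]

/-! ### The step law and the walk. -/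

/-- The characteristic function of the step law. -/
noncomputable def stepChar {N : ℕ} (α : Fin N → ℝ) (p₀ : ℝ) (p : Fin N → ℝ) (t : ℝ) : ℝ :=
  p₀ + ∑ i, p i * Real.cos (α i * t)

lemma charFun_stepLaw {N : ℕ} (α : Fin N → ℝ) {p₀ : ℝ} {p : Fin N → ℝ} (hp₀ : 0 ≤ p₀)
    (hp : ∀ i, 0 ≤ p i) (t : ℝ) : charFun (stepLaw α p₀ p) t = stepChar α p₀ p t := by
  have hint : ∀ a : ℝ, Integrable (fun x : ℝ => Complex.exp (t * x * Complex.I))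
      (Measure.dirac a) := fun a => integrable_dirac (by simp)
  have hint2 : ∀ i, Integrable (fun x : ℝ => Complex.exp (t * x * Complex.I))
      (ENNReal.ofReal (p i / 2) • (Measure.dirac (α i) + Measure.dirac (-α i))) := fun i =>
    ((hint _).add_measure (hint _)).smul_measure ENNReal.ofReal_ne_top
  rw [charFun_apply_real, stepLaw, integral_add_measure
    ((hint 0).smul_measure ENNReal.ofReal_ne_top)
    (integrable_finsetSum_measure.2 fun i _ => hint2 i),
    integral_finsetSum_measure fun i _ => hint2 i, stepChar]
  simp only [integral_smul_measure, integral_dirac, ENNReal.toReal_ofReal hp₀]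
  push_cast
  congr 1
  · simp
  · refine Finset.sum_congr rfl fun i _ => ?_
    rw [integral_add_measure (hint _) (hint _), integral_dirac, integral_dirac,
      ENNReal.toReal_ofReal (by linarith [hp i]), Complex.cos, Complex.real_smul]
    push_cast
    ring_nf

/-- Writing 1 - cos through the Fejér kernel makes the second-order expansion exact, with a
continuous coefficient equal to σ² at 0. -/
lemma stepChar_eq {N : ℕ} (α : Fin N → ℝ) {p₀ : ℝ} {p : Fin N → ℝ}
    (hsum : p₀ + ∑ i, p i = 1) (t : ℝ) :
    stepChar α p₀ p t = 1 - t ^ 2 / 2 * ∑ i, p i * α i ^ 2 * fejerKernel (α i * t) := by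
  rw [stepChar, ← hsum, add_sub_assoc, Finset.mul_sum, ← Finset.sum_sub_distrib]
  congr 1
  refine Finset.sum_congr rfl fun i _ => ?_
  linear_combination (p i / 2) * fejerKernel_mul_sq (α i * t)

lemma charFun_map_walk {N : ℕ} {α : Fin N → ℝ} {p₀ : ℝ} {p : Fin N → ℝ} (hp₀ : 0 ≤ p₀)
    (hp : ∀ i, 0 ≤ p i) {Ω : Type*} [MeasurableSpace Ω] {P : Measure Ω}
    {u : ℕ → Ω → ℝ} (hindep : iIndepFun u P) (hlaw : ∀ j, HasLaw (u j) (stepLaw α p₀ p) P)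
    (m : ℕ) (r w : ℝ) :
    charFun (P.map fun ω => r * walk u m ω) w = (stepChar α p₀ p (r * w) ^ m : ℝ) := by
  have hmeas : ∀ j, AEMeasurable (u j) P := fun j => (hlaw j).aemeasurable
  unfold walk
  rw [charFun_map_mul_comp (Finset.aemeasurable_fun_sum _ fun j _ => hmeas j),
    (hindep.restrict _).charFun_map_fun_finsetSum_eq_prod fun j _ => hmeas j]
  simp [(hlaw _).map_eq, charFun_stepLaw α hp₀ hp]

theorem theorem4p5 (N : ℕ) (hN : 1 ≤ N)
    (α : Fin N → ℝ) (hα : LinearIndependent ℚ α)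
    (p₀ : ℝ) (p : Fin N → ℝ) (hp₀ : 0 < p₀) (hp : ∀ i, 0 < p i ∧ p i < 1)
    (hsum : p₀ + ∑ i, p i = 1)
    {Ω : Type*} [MeasurableSpace Ω] (P : Measure Ω) [IsProbabilityMeasure P]
    (u : ℕ → Ω → ℝ) (hindep : iIndepFun u P)
    (hlaw : ∀ j, HasLaw (u j) (stepLaw α p₀ p) P)
    (γ : ℝ) (hγ : γ ∈ Set.Ioo (0 : ℝ) (1 / 2))
    (δ : ℕ → ℝ) (hδpos : ∀ n, 1 ≤ n → 0 < δ n)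
    (hδlim : Filter.Tendsto δ Filter.atTop (nhds 0))
    (hδ : ∀ n : ℕ, 1 ≤ n → (n : ℝ) ^ (-(1 / 2 - γ)) ≤ δ n) :
    Asymptotics.IsEquivalent Filter.atTop
      (fun n : ℕ => P.real {ω | walk u (2 * n) ω ∈ Set.Ioo (-(δ n)⁻¹) (δ n)⁻¹})
      (fun n : ℕ => 2 * (δ n)⁻¹ *
        (1 / (Real.sqrt (2 * Real.pi * (2 * (n : ℝ))) * stepSigma α p))) := by
  set q : ℝ → ℝ := fun t => ∑ i, p i * α i ^ 2 * fejerKernel (α i * t) with hq_def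
  have hqc : Continuous q := by
    have := continuous_fejerKernel
    fun_prop
  have hq0 : q 0 = ∑ i, p i * α i ^ 2 := by simp [hq_def, fejerKernel_zero]
  have hq0pos : 0 < q 0 := by
    rw [hq0]
    have : Nonempty (Fin N) := ⟨⟨0, hN⟩⟩
    refine Finset.sum_pos (fun i _ => ?_) Finset.univ_nonempty
    -- Linear independence serves only to give α_i ≠ 0, hence σ > 0.
    have := hα.ne_zero i
    have := (hp i).1
    positivity
  have hσ : stepSigma α p = √(q 0) := by rw [stepSigma, hq0]
  have hφc : Continuous (stepChar α p₀ p) := by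
    unfold stepChar
    fun_prop
  have hwalk : ∀ n, AEMeasurable (fun ω => (δ n) * walk u (2 * n) ω) P := fun n =>
    (Finset.aemeasurable_fun_sum _ fun j _ => (hlaw j).aemeasurable).const_mul _
  have hprob : ∀ n, IsProbabilityMeasure (P.map fun ω => δ n * walk u (2 * n) ω) := fun n =>
    Measure.isProbabilityMeasure_map (hwalk n)
  have hR : Tendsto (fun n => (δ n)⁻¹) atTop atTop :=
    tendsto_inv_nhdsGT_zero.comp (tendsto_nhdsWithin_iff.2 ⟨hδlim, by
      filter_upwards [eventually_ge_atTop 1] with n hn using hδpos n hn⟩)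
  have hm : Tendsto (fun n : ℕ => 2 * n) atTop atTop := tendsto_id.const_mul_atTop' two_pos
  have hRm : Tendsto (fun n : ℕ => (δ n)⁻¹ / √((2 * n : ℕ) : ℝ)) atTop (𝓝 0) := by
    have hlim : Tendsto (fun n : ℕ => (n : ℝ) ^ (-γ)) atTop (𝓝 0) :=
      (tendsto_rpow_neg_atTop hγ.1).comp tendsto_natCast_atTop_atTop
    refine tendsto_of_tendsto_of_tendsto_of_le_of_le' tendsto_const_nhds hlim ?_ ?_
    · filter_upwards [eventually_ge_atTop 1] with n hn
      have := hδpos n hn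
      positivity
    · filter_upwards [eventually_ge_atTop 1] with n hn
      have hn0 : (0 : ℝ) < n := by exact_mod_cast hn
      -- The lower bound on δ_n gives R ≤ n^{1/2 - γ}, so R / √(2n) ≤ n^{-γ}.
      calc (δ n)⁻¹ / √((2 * n : ℕ) : ℝ) ≤ ((n : ℝ) ^ (-(1 / 2 - γ)))⁻¹ / √(n : ℝ) := by
            have := hδ n hn
            gcongr
            linarith
        _ = (n : ℝ) ^ (-γ) := by
            rw [← Real.rpow_neg hn0.le, Real.sqrt_eq_rpow, ← Real.rpow_sub hn0]
            congr 1
            ring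
  have key := tendsto_measureReal_Ioo_of_charFun_eq_pow hφc hqc.continuousAt hq0pos
    (stepChar_eq α hsum) hR hm hRm
    (μ := fun n => P.map fun ω => δ n * walk u (2 * n) ω) (fun n w => by
      rw [charFun_map_walk hp₀.le (fun i => (hp i).1.le) hindep hlaw, div_inv_eq_mul, mul_comm w])
  have hpos : ∀ n : ℕ, 1 ≤ n → 0 < 2 * (δ n)⁻¹ *
      (1 / (√(2 * Real.pi * (2 * (n : ℝ))) * stepSigma α p)) := fun n hn => by
    have hn0 : (0 : ℝ) < n := by exact_mod_cast hn
    have := hδpos n hn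
    rw [hσ]
    positivity
  refine (Asymptotics.isEquivalent_iff_tendsto_one ?_).2 ?_
  · filter_upwards [eventually_ge_atTop 1] with n hn using (hpos n hn).ne'
  have key' := key.const_mul Real.pi
  rw [mul_inv_cancel₀ Real.pi_ne_zero] at key'
  refine key'.congr' ?_
  filter_upwards [eventually_ge_atTop 1] with n hn
  have hn0 : (0 : ℝ) < n := by exact_mod_cast hn
  have hδn := hδpos n hn
  have hset : (P.map fun ω => δ n * walk u (2 * n) ω).real (Set.Ioo (-1) 1) =
      P.real {ω | walk u (2 * n) ω ∈ Set.Ioo (-(δ n)⁻¹) (δ n)⁻¹} := by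
    rw [map_measureReal_apply_of_aemeasurable (hwalk n) measurableSet_Ioo]
    congr 1
    ext ω
    rw [Set.mem_preimage, Set.mem_ofPred_eq, Set.mem_Ioo, Set.mem_Ioo, ← abs_lt, ← abs_lt, abs_mul,
      abs_of_pos hδn, ← one_div, lt_div_iff₀' hδn]
  rw [hset, Pi.div_apply, hσ]
  set x := P.real {ω | walk u (2 * n) ω ∈ Set.Ioo (-(δ n)⁻¹) (δ n)⁻¹}
  have hq0' : 0 < √(q 0) := Real.sqrt_pos.2 hq0pos
  have h2pi : 0 < √(2 * Real.pi) := by positivity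
  have hsn : 0 < √(2 * (n : ℝ)) := by positivity
  rw [Real.sqrt_div (by positivity), Real.sqrt_mul (by positivity) (2 * (n : ℝ))]
  push_cast
  field_simp
  rw [Real.sq_sqrt (by positivity)]
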